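/- Let $N$ be a random variable with values in $\{0,1,2,\dots\}\cup\{\infty\}$ and law $d$, and let $H(s)=\mathbb E[s^N]$ for $s\in[0,1]$, where $s^\infty=0$ for $s<1$ and $1^\infty=1$. Suppose that $H(0)=0$ and that $H$ is strictly convex on $[0,1]$. Let $\mathcal P$ be the set of probability measures on $[0,1]$ with the weak topology, and for $\nu\in\mathcal P$ let $\mathcal T(\nu)$ be the law of $1-\prod_{i=1}^N X_i$, where the $X_i$ are i.i.d. with law $\nu$ and independent of $N$. Let $\delta$ be the law on $\{0,1\}$ with $\mathcal T(\delta)=\delta$, and let $\mu^1$ be its mean. Let $\mathbf T$ be the tree of all finite sequences of positive integers, and $|u|$ the length of $u\in\mathbf T$. A tree-indexed solution consists of i.i.d. random variables $(N_u)_{u\in\mathbf T}$ with law $d$ and $[0,1]$-valued random variables $(X_u)_{u\in\mathbf T}$, all with the same law, such that for every $n$ the variables $(X_u;|u|=n)$ are mutually independent and, as a family, independent of $(N_v;|v|\le n-1)$, and such that $X_u=1-\prod_{i=1}^{N_u}X_{ui}$ almost surely for every $u$. It is endogenous if every $X_u$ is, up to null sets, measurable with respect to $\sigma(N_v;v\in\mathbf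 T)$. Suppose that $H'(\mu^1)\le 1$. Then an endogenous tree-indexed solution exists, and the law $\varsigma$ of $X_\emptyset$ in any endogenous tree-indexed solution is $\varsigma=\delta$. Moreover, its basin of attraction $B(\varsigma)=\{\nu\in\mathcal P:\mathcal T^n(\nu)\to\varsigma\text{ weakly}\}$ is $$B(\varsigma)=\Big\{\nu\in\mathcal P:\int x\,d\nu(x)\in b(\mu^1)\Big\},$$ where $b(\mu^1)$ is the set of $t\in[0,1]$ whose iterates under $f:t\mapsto 1-H(t)$ converge to $\mu^1$. -/

import Mathlib

open MeasureTheory ProbabilityTheory Set Filter Topology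
open scoped unitInterval

namespace NoisyVeto

/-- The product `∏_{i < n} x i` of the first `n` terms of a sequence in `[0,1]`, for
`n ∈ {0, 1, 2, …, ∞}`. The partial products decrease, so that for `n = ∞` the infimum is
their limit. -/
noncomputable def liveProd : ℕ∞ → (ℕ → I) → I
  | (k : ℕ), x => ∏ i ∈ Finset.range k, x i
  | ⊤, x => ⨅ k : ℕ, ∏ i ∈ Finset.range k, x i

theorem liveProd_coe (k : ℕ) (x : ℕ → I) :
    liveProd (k : ℕ∞) x = ∏ i ∈ Finset.range k, x i := rfl

theorem liveProd_top (x : ℕ → I) : liveProd ⊤ x = ⨅ k : ℕ, ∏ i ∈ Finset.range k, x i := rfl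

/-- The right-hand side `1 - ∏_{i < n} x i` of the recursion. -/
noncomputable def veto (n : ℕ∞) (x : ℕ → I) : I := unitInterval.symm (liveProd n x)

theorem measurable_veto : Measurable fun q : ℕ∞ × (ℕ → I) => veto q.1 q.2 := by
  refine measurable_from_prod_countable_right fun n => ?_
  refine unitInterval.continuous_symm.measurable.comp ?_
  have h : ∀ k : ℕ, Measurable fun x : ℕ → I => ∏ i ∈ Finset.range k, x i :=
    fun k => (continuous_finsetProd _ fun i _ => continuous_apply i).measurable
  induction n using ENat.recTopCoe with
  | top => exact Measurable.iInf h
  | coe k => exact h k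

/-- `𝒯 ν`: the law of `1 - ∏_{i < N} X_i`, where `N` has law `d`, the `X_i` are i.i.d. with
law `ν`, and `N` is independent of them. -/
noncomputable def lawMap (d : Measure ℕ∞) [IsProbabilityMeasure d]
    (ν : ProbabilityMeasure I) : ProbabilityMeasure I :=
  ProbabilityMeasure.map
    (⟨d.prod (Measure.infinitePi fun _ : ℕ => (ν : Measure I)), inferInstance⟩ :
      ProbabilityMeasure (ℕ∞ × (ℕ → I)))
    measurable_veto.aemeasurable

/-- The generating function `H(s) = E[s ^ N]`, `s ∈ [0,1]`, of a law `d` on `{0, 1, 2, …, ∞}`,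
where `s ^ ∞` is the infinite product: `1` if `s = 1`, and `0` if `0 ≤ s < 1`. -/
noncomputable def genFun (d : Measure ℕ∞) (s : ℝ) : ℝ :=
  (∑' k : ℕ, d.real {(k : ℕ∞)} * s ^ k) + if s = 1 then d.real {⊤} else 0

/-- The mean of a probability measure on `[0,1]`. -/
noncomputable def mean (ν : ProbabilityMeasure I) : ℝ := ∫ x : I, (x : ℝ) ∂(ν : Measure I)

/-- The basin of attraction of `a` under iteration of `f`. -/
def basin {α : Type*} [TopologicalSpace α] (f : α → α) (a : α) : Set α :=
  {x | Tendsto (fun n : ℕ => f^[n] x) atTop (𝓝 a)}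

/-- `δ` is an invariant law of the recursion that is concentrated on `{0,1}`. -/
structure IsDiscreteLaw (d : Measure ℕ∞) [IsProbabilityMeasure d]
    (δ : ProbabilityMeasure I) : Prop where
  invariant : lawMap d δ = δ
  concentrated : (δ : Measure I) {0, 1}ᶜ = 0

/-- `X` is a tree-indexed solution of the recursion `X_u = 1 - ∏_{i < N_u} X_{ui}` with i.i.d.
family sizes `N_u` of law `d`. The nodes of the tree are the finite sequences `u` of natural
numbers, the depth of `u` is its length, and the daughters of `u` are the `u ++ [i]`, `i ∈ ℕ`. -/
structure IsTreeSolution {Ω : Type*} [MeasurableSpace Ω] (P : Measure Ω)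
    (d : Measure ℕ∞) (N : List ℕ → Ω → ℕ∞) (X : List ℕ → Ω → I) : Prop where
  measurable_size : ∀ u, Measurable (N u)
  law_size : ∀ u, P.map (N u) = d
  indep_size : iIndepFun N P
  measurable_sol : ∀ u, Measurable (X u)
  indep_level : ∀ n : ℕ, iIndepFun (fun u : {u : List ℕ // u.length = n} => X u) P
  indep_past : ∀ n : ℕ, IndepFun
    (fun ω (u : {u : List ℕ // u.length = n}) => X u ω)
    (fun ω (v : {v : List ℕ // v.length < n}) => N v ω) P
  recursion : ∀ u, ∀ᵐ ω ∂P, X u ω = veto (N u ω) fun i => X (u ++ [i]) ω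
  stationary : ∀ u, P.map (X u) = P.map (X [])

/-- The process `X` is, up to null sets, measurable with respect to the family sizes `N`. -/
def IsEndogenous {Ω : Type*} [MeasurableSpace Ω] (P : Measure Ω)
    (N : List ℕ → Ω → ℕ∞) (X : List ℕ → Ω → I) : Prop :=
  ∀ u, ∃ g : (List ℕ → ℕ∞) → I, Measurable g ∧ ∀ᵐ ω ∂P, X u ω = g fun v => N v ω

/-- `ς` is the law at the root of an endogenous tree-indexed solution. -/
def IsEndogenousLaw (d : Measure ℕ∞) (ς : ProbabilityMeasure I) : Prop :=
  ∃ (Ω : Type) (_ : MeasurableSpace Ω) (P : Measure Ω) (N : List ℕ → Ω → ℕ∞)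
    (X : List ℕ → Ω → I), IsProbabilityMeasure P ∧ IsTreeSolution P d N X ∧
      IsEndogenous P N X ∧ (ς : Measure I) = P.map (X [])

end NoisyVeto

/-! Write `H` for the generating function and `m` for the mean of `δ`. The map `𝒯` acts on the first
two moments by a closed recursion: the mean `a` goes to `1 - H a`, and the second moment `x` goes to
`1 - 2 * H a + H x`, because a product of two vetoes over the same family is again expressed through
products over that family. Once `a` is close to `m`, the second moment nearly follows `t ↦ 2 * m - 1
+ H t`, which fixes `m`. Strict convexity and `H' m ≤ 1` put this map strictly above the diagonal on
`[0, m)` (`lt_add_genFun`), so the second moment is pushed up to `m` (`tendsto_second_moment`). A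
limit whose first two moments agree lives on `{0,1}` and is determined by its mean, hence is `δ`
(`tendsto_of_tendsto_moments`). This yields the basin.

The root law of any tree-indexed solution is invariant. Its mean is the unique fixed point `m` of
the decreasing map `1 - H`, so it lies in the basin and equals `δ`.

For existence, iterate the recursion on the space of family sizes, starting from the constant `m`.
The mixed moments obey the same second moment recursion, so the iterates are Cauchy in mean square.
Their limit is a function of the family sizes and solves the recursion (`exists_step_eq`). -/

namespace NoisyVeto

set_option linter.unusedSectionVars false

/-! ### Regularity of the generating function on `[0,1]`. -/

section GeneratingFunction

variable (d : Measure ℕ∞) [IsProbabilityMeasure d]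

/-- The power series part of the generating function, which ignores the mass at `∞`. -/
noncomputable def powerSum (s : ℝ) : ℝ := ∑' k : ℕ, d.real {(k : ℕ∞)} * s ^ k

theorem tsum_enat {f : ℕ∞ → ℝ} (hf : Summable f) : ∑' n, f n = (∑' k : ℕ, f k) + f ⊤ := by
  classical
  rw [hf.tsum_eq_add_tsum_ite ⊤, add_comm, ← Nat.cast_injective (R := ℕ∞).tsum_eq]
  · simp
  · intro n hn
    induction n using ENat.recTopCoe with
    | top => simp at hn
    | coe k => exact ⟨k, rfl⟩

theorem summable_real_singleton : Summable fun n : ℕ∞ => d.real {n} := by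
  have h := hasSum_integral_measure (μ := fun n : ℕ∞ => d {n} • Measure.dirac n)
    (f := fun _ => (1 : ℝ)) (by rw [Measure.sum_smul_dirac]; exact integrable_const _)
  simpa [integral_smul_measure, measureReal_def] using h.summable

theorem summable_real_natCast : Summable fun k : ℕ => d.real {(k : ℕ∞)} :=
  (summable_real_singleton d).comp_injective Nat.cast_injective

theorem tsum_real_natCast : (∑' k : ℕ, d.real {(k : ℕ∞)}) + d.real {⊤} = 1 := by
  rw [← tsum_enat (summable_real_singleton d)]
  have := integral_countable (μ := d) (f := fun _ => (1 : ℝ)) (integrable_const _)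
  simpa using this.symm

theorem genFun_one : genFun d 1 = 1 := by
  simpa [genFun] using tsum_real_natCast d

theorem genFun_of_ne_one {s : ℝ} (hs : s ≠ 1) : genFun d s = powerSum d s := by
  simp [genFun, powerSum, hs]

theorem norm_powerSum_term_le {s : ℝ} (hs : |s| ≤ 1) (k : ℕ) :
    ‖d.real {(k : ℕ∞)} * s ^ k‖ ≤ d.real {(k : ℕ∞)} := by
  rw [norm_mul, norm_pow, Real.norm_eq_abs, Real.norm_eq_abs, abs_of_nonneg measureReal_nonneg]
  exact mul_le_of_le_one_right measureReal_nonneg (pow_le_one₀ (abs_nonneg _) hs)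

theorem summable_powerSum_term {s : ℝ} (hs : |s| ≤ 1) :
    Summable fun k : ℕ => d.real {(k : ℕ∞)} * s ^ k :=
  .of_norm_bounded (summable_real_natCast d) (norm_powerSum_term_le d hs)

theorem continuousOn_powerSum : ContinuousOn (powerSum d) (Icc (-1) 1) :=
  continuousOn_tsum (fun _ => by fun_prop) (summable_real_natCast d)
    fun k _ hs => norm_powerSum_term_le d (abs_le.2 hs) k

theorem monotoneOn_powerSum : MonotoneOn (powerSum d) (Icc 0 1) := fun s hs t ht hst =>
  Summable.tsum_le_tsum
    (fun k => mul_le_mul_of_nonneg_left (pow_le_pow_left₀ hs.1 hst k) measureReal_nonneg)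
    (summable_powerSum_term d (by rw [abs_of_nonneg hs.1]; exact hs.2))
    (summable_powerSum_term d (by rw [abs_of_nonneg ht.1]; exact ht.2))

theorem powerSum_le_genFun (s : ℝ) : powerSum d s ≤ genFun d s := by
  rw [genFun, powerSum]
  split_ifs <;> simp

theorem monotoneOn_genFun : MonotoneOn (genFun d) (Icc 0 1) := fun s hs t ht hst => by
  rcases hst.eq_or_lt with rfl | h
  · rfl
  rw [genFun_of_ne_one d (h.trans_le ht.2).ne]
  exact (monotoneOn_powerSum d hs ht hst).trans (powerSum_le_genFun d t)

theorem continuousAt_genFun {s : ℝ} (hs : s ∈ Ioo (-1) 1) : ContinuousAt (genFun d) s := by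
  refine ((continuousOn_powerSum d).continuousAt (Icc_mem_nhds hs.1 hs.2)).congr ?_
  filter_upwards [isOpen_Ioo.mem_nhds hs] with t ht
  exact (genFun_of_ne_one d ht.2.ne).symm

theorem differentiableAt_genFun {s : ℝ} (hs : s ∈ Ioo (-1) 1) :
    DifferentiableAt ℝ (genFun d) s := by
  -- The complex power series is holomorphic on the open unit disc; its restriction to the reals
  -- gives the derivative.
  have h : DifferentiableOn ℂ
      (fun z : ℂ => ∑' k : ℕ, ((d.real {(k : ℕ∞)} : ℝ) : ℂ) * z ^ k) (Metric.ball 0 1) := by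
    refine Complex.differentiableOn_tsum_of_summable_norm (summable_real_natCast d)
      (fun k => by fun_prop) Metric.isOpen_ball fun k z hz => ?_
    rw [norm_mul, norm_pow, Complex.norm_real, Real.norm_of_nonneg measureReal_nonneg]
    exact mul_le_of_le_one_right measureReal_nonneg
      (pow_le_one₀ (norm_nonneg _) (by simpa using (mem_ball_zero_iff.1 hz).le))
  have hsb : (s : ℂ) ∈ Metric.ball (0 : ℂ) 1 := by
    rw [mem_ball_zero_iff, Complex.norm_real, Real.norm_eq_abs]; exact abs_lt.2 hs
  have h2 := (h.differentiableAt (Metric.isOpen_ball.mem_nhds hsb)).hasDerivAt.real_of_complex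
  refine h2.differentiableAt.congr_of_eventuallyEq ?_
  filter_upwards [isOpen_Ioo.mem_nhds hs] with t ht
  rw [genFun_of_ne_one d ht.2.ne, powerSum, ← Complex.ofReal_re (∑' k : ℕ, _)]
  push_cast
  rfl

end GeneratingFunction

/-! ### Fixed points and the scalar dynamics of the two moments. -/

section Iteration

variable {d : Measure ℕ∞} [IsProbabilityMeasure d] {m : ℝ}

theorem eq_of_fixed (hm : m ∈ Icc (0 : ℝ) 1) (hfix : m = 1 - genFun d m) {t : ℝ}
    (ht : t ∈ Icc (0 : ℝ) 1) (htf : t = 1 - genFun d t) : t = m := by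
  rcases le_total t m with h | h
  · have := monotoneOn_genFun d ht hm h; linarith
  · have := monotoneOn_genFun d hm ht h; linarith

theorem fixed_mem_Ioo (hzero : genFun d 0 = 0) (hm : m ∈ Icc (0 : ℝ) 1)
    (hfix : m = 1 - genFun d m) : m ∈ Ioo (0 : ℝ) 1 := by
  refine ⟨hm.1.lt_of_ne ?_, hm.2.lt_of_ne ?_⟩
  · rintro rfl; rw [hzero] at hfix; norm_num at hfix
  · rintro rfl; rw [genFun_one] at hfix; norm_num at hfix

/-- By strict convexity the chord from `t` to `m` has slope below `H' m ≤ 1`; now substitute `H m =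
1 - m`. This is the only place where stability enters. -/
theorem lt_add_genFun (hconv : StrictConvexOn ℝ (Icc (0 : ℝ) 1) (genFun d))
    (hm : m ∈ Ioo (0 : ℝ) 1) (hfix : m = 1 - genFun d m) (hstable : deriv (genFun d) m ≤ 1)
    {t : ℝ} (ht : 0 ≤ t) (htm : t < m) : t < 2 * m - 1 + genFun d t := by
  have h := hconv.slope_lt_deriv ⟨ht, (htm.trans hm.2).le⟩ ⟨hm.1.le, hm.2.le⟩ htm
    (differentiableAt_genFun d ⟨by linarith [hm.1], hm.2⟩)
  have h1 := h.trans_le hstable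
  rw [slope_def_field, div_lt_one (by linarith)] at h1
  linarith

/-- Second moments of a sequence of laws on `[0,1]` converge to the same limit as the means. -/
theorem tendsto_second_moment (hconv : StrictConvexOn ℝ (Icc (0 : ℝ) 1) (genFun d))
    (hm : m ∈ Ioo (0 : ℝ) 1) (hfix : m = 1 - genFun d m) (hstable : deriv (genFun d) m ≤ 1)
    {a x : ℕ → ℝ} (ha : Tendsto a atTop (𝓝 m)) (ha1 : ∀ n, a n ≤ 1) (hx0 : ∀ n, 0 ≤ x n)
    (hxa : ∀ n, x n ≤ a n) (hx : ∀ n, x (n + 1) = 1 - 2 * genFun d (a n) + genFun d (x n)) :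
    Tendsto x atTop (𝓝 m) := by
  have hx1 n : x n ≤ 1 := (hxa n).trans (ha1 n)
  have hbdd : IsBoundedUnder (· ≥ ·) atTop x := ⟨0, by simp [hx0]⟩
  have hcobdd : IsCoboundedUnder (· ≥ ·) atTop x :=
    IsBoundedUnder.isCoboundedUnder_ge ⟨1, by simp [hx1]⟩
  have hHa : Tendsto (fun n => genFun d (a n)) atTop (𝓝 (genFun d m)) :=
    (continuousAt_genFun d ⟨by linarith [hm.1], hm.2⟩).tendsto.comp ha
  -- If the liminf `L` were below `m`, one step of the recursion would lift all late terms beyond `L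
  -- + ε`.
  have hlim : m ≤ liminf x atTop := by
    by_contra! hL
    set L := liminf x atTop with hLdef
    have hL0 : 0 ≤ L := le_liminf_of_le hcobdd (by simp [hx0])
    have hg := lt_add_genFun hconv hm hfix hstable hL0 hL
    have hcont : ContinuousAt (fun t => 2 * m - 1 + genFun d t - t) L :=
      (continuousAt_const.add (continuousAt_genFun d ⟨by linarith, hL.trans hm.2⟩)).sub
        continuousAt_id
    obtain ⟨η, hη, hball⟩ := Metric.eventually_nhds_iff.1
      (hcont.eventually (lt_mem_nhds (show (2 * m - 1 + genFun d L - L) / 2 < _ by linarith)))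
    set c := (2 * m - 1 + genFun d L - L) / 2 with hc
    have hcpos : 0 < c := by rw [hc]; linarith
    -- Near `L` the gain is at least `c`. The losses are `ε` from `p` in place of `L` and `ε` from
    -- twice the error in `H (a n)`; `c / 4` leaves a net gain above `ε`. The truncation of `p` at
    -- `0` keeps it where `H` is monotone.
    set ε := min (η / 2) (c / 4) with hε
    have hεpos : 0 < ε := lt_min (by linarith) (by linarith)
    have hεη : ε < η := (min_le_left _ _).trans_lt (by linarith)
    have hεc : ε ≤ c / 4 := min_le_right _ _
    set p := max (L - ε) 0 with hp
    have hpL : p ≤ L := max_le (by linarith) hL0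
    have hpL' : L - ε ≤ p := le_max_left _ _
    have hgp := @hball p (by rw [Real.dist_eq, abs_lt]; constructor <;> linarith)
    have h1 : ∀ᶠ n in atTop, p ≤ x n := by
      filter_upwards [eventually_lt_of_lt_liminf (show L - ε < liminf x atTop by linarith) hbdd]
        with n hn
      exact max_le hn.le (hx0 n)
    have h2 : ∀ᶠ n in atTop, genFun d (a n) < genFun d m + ε / 2 :=
      hHa.eventually (gt_mem_nhds (by linarith))
    have h3 : ∀ᶠ n in atTop, L + ε ≤ x (n + 1) := by
      filter_upwards [h1, h2] with n hn1 hn2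
      have := monotoneOn_genFun d ⟨le_max_right _ _, hn1.trans (hx1 n)⟩ ⟨hx0 n, hx1 n⟩ hn1
      rw [hx]
      linarith
    have h4 : L + ε ≤ liminf x atTop :=
      le_liminf_of_le hcobdd (by rwa [← map_add_atTop_eq_nat 1, eventually_map])
    linarith
  refine tendsto_order.2 ⟨fun b hb => eventually_lt_of_lt_liminf (hb.trans_le hlim) hbdd,
    fun b hb => ?_⟩
  filter_upwards [ha.eventually (gt_mem_nhds hb)] with n hn
  exact (hxa n).trans_lt hn

end Iteration

/-! ### Expectations of products over a random number of i.i.d. factors. -/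

section LiveProd

theorem antitone_partialProd (x : ℕ → I) : Antitone fun k : ℕ => ∏ i ∈ Finset.range k, x i :=
  antitone_nat_of_succ_le fun k => by
    rw [Finset.prod_range_succ]; exact unitInterval.mul_le_left

theorem tendsto_partialProd (x : ℕ → I) :
    Tendsto (fun k : ℕ => ∏ i ∈ Finset.range k, x i) atTop (𝓝 (liveProd ⊤ x)) :=
  tendsto_atTop_iInf (antitone_partialProd x)

theorem liveProd_mul (n : ℕ∞) (x y : ℕ → I) :
    liveProd n (fun i => x i * y i) = liveProd n x * liveProd n y := by
  induction n using ENat.recTopCoe with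
  | coe k => simp [liveProd_coe, Finset.prod_mul_distrib]
  | top =>
    refine tendsto_nhds_unique (tendsto_partialProd _) ?_
    simpa [Finset.prod_mul_distrib] using (tendsto_partialProd x).mul (tendsto_partialProd y)

theorem measurable_liveProd : Measurable fun q : ℕ∞ × (ℕ → I) => liveProd q.1 q.2 := by
  simpa [veto, Function.comp_def] using
    unitInterval.continuous_symm.measurable.comp measurable_veto

theorem coe_veto (n : ℕ∞) (x : ℕ → I) : ((veto n x : I) : ℝ) = 1 - (liveProd n x : ℝ) := rfl

theorem coe_partialProd (s : Finset ℕ) (x : ℕ → I) :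
    ((∏ i ∈ s, x i : I) : ℝ) = ∏ i ∈ s, (x i : ℝ) := by
  classical
  induction s using Finset.induction_on with
  | empty => simp
  | insert a s ha ih => simp [Finset.prod_insert ha, ih]

theorem integrable_coe {Ω : Type*} [MeasurableSpace Ω] {P : Measure Ω} [IsFiniteMeasure P]
    {c : Ω → I} (hc : Measurable c) : Integrable (fun ω => (c ω : ℝ)) P :=
  .of_bound (by fun_prop) 1 (ae_of_all _ fun ω => by
    rw [Real.norm_of_nonneg (c ω).2.1]; exact (c ω).2.2)

theorem integral_coe_mem {Ω : Type*} [MeasurableSpace Ω] {P : Measure Ω} [IsProbabilityMeasure P]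
    {c : Ω → I} (hc : Measurable c) : ∫ ω, (c ω : ℝ) ∂P ∈ Icc (0 : ℝ) 1 := by
  refine ⟨integral_nonneg fun ω => (c ω).2.1, ?_⟩
  simpa using integral_mono (integrable_coe hc) (integrable_const (1 : ℝ)) (μ := P)
    fun ω => (c ω).2.2

variable {A : Type*} [MeasurableSpace A] (ρ : Measure A) [IsProbabilityMeasure ρ]
  {c : A → I}

theorem integral_partialProd (hc : Measurable c) (k : ℕ) :
    ∫ y, ((∏ i ∈ Finset.range k, c (y i) : I) : ℝ) ∂(Measure.infinitePi fun _ : ℕ => ρ) =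
      (∫ a, (c a : ℝ) ∂ρ) ^ k := by
  have h := integral_restrict_infinitePi (μ := fun _ : ℕ => ρ) (s := Finset.range k)
    (f := fun y => ∏ i, (c (y i) : ℝ)) (Measurable.aestronglyMeasurable (by fun_prop))
  rw [integral_fintype_prod_eq_prod (f := fun _ a => (c a : ℝ))] at h
  simp only [Finset.prod_const, Finset.card_univ, Fintype.card_coe, Finset.card_range] at h
  rw [← h]
  refine integral_congr_ae (ae_of_all _ fun y => ?_)
  simp only [Finset.restrict]
  rw [Finset.prod_coe_sort (Finset.range k) fun i => (c (y i) : ℝ)]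
  exact coe_partialProd _ _

/-- The powers of the mean tend to `0` unless the mean is `1`, which is exactly the convention for
`s ^ ∞` in `genFun`. -/
theorem integral_liveProd_top (hc : Measurable c) :
    ∫ y, (liveProd ⊤ (fun i => c (y i)) : ℝ) ∂(Measure.infinitePi fun _ : ℕ => ρ) =
      if ∫ a, (c a : ℝ) ∂ρ = 1 then 1 else 0 := by
  have h := tendsto_integral_of_dominated_convergence
    (μ := Measure.infinitePi fun _ : ℕ => ρ)
    (F := fun (k : ℕ) (y : ℕ → A) => ((∏ i ∈ Finset.range k, c (y i) : I) : ℝ))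
    (f := fun y => (liveProd ⊤ (fun i => c (y i)) : ℝ)) (fun _ => 1)
    (fun k => Measurable.aestronglyMeasurable (by fun_prop)) (integrable_const _)
    (fun k => ae_of_all _ fun y => by
      rw [Real.norm_of_nonneg (unitInterval.nonneg _)]; exact unitInterval.le_one _)
    (ae_of_all _ fun y => (continuous_subtype_val.tendsto _).comp (tendsto_partialProd _))
  simp only [integral_partialProd ρ hc] at h
  refine tendsto_nhds_unique h ?_
  have hmem := integral_coe_mem (P := ρ) hc
  split_ifs with h1
  · simp [h1]
  · exact tendsto_pow_atTop_nhds_zero_of_lt_one hmem.1 (hmem.2.lt_of_ne h1)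

variable (d : Measure ℕ∞) [IsProbabilityMeasure d]

theorem measurable_liveProd_comp (hc : Measurable c) :
    Measurable fun q : ℕ∞ × (ℕ → A) => liveProd q.1 (fun i => c (q.2 i)) :=
  measurable_liveProd.comp (f := fun q : ℕ∞ × (ℕ → A) => (q.1, fun i => c (q.2 i))) (by fun_prop)

theorem integral_liveProd (hc : Measurable c) :
    ∫ q, (liveProd q.1 (fun i => c (q.2 i)) : ℝ)
      ∂(d.prod (Measure.infinitePi fun _ : ℕ => ρ)) = genFun d (∫ a, (c a : ℝ) ∂ρ) := by
  have hint : Integrable (fun q : ℕ∞ × (ℕ → A) => (liveProd q.1 (fun i => c (q.2 i)) : ℝ))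
      (d.prod (Measure.infinitePi fun _ : ℕ => ρ)) := integrable_coe (measurable_liveProd_comp hc)
  have h2 := hint.integral_prod_left
  rw [integral_prod _ hint, integral_countable h2, tsum_enat]
  · simp [liveProd_coe, integral_partialProd ρ hc, integral_liveProd_top ρ hc, genFun]
  · refine .of_norm_bounded (summable_real_singleton d) fun n => ?_
    rw [norm_smul, Real.norm_of_nonneg measureReal_nonneg]
    refine mul_le_of_le_one_right measureReal_nonneg ?_
    have := integral_coe_mem (P := Measure.infinitePi fun _ : ℕ => ρ)
      (c := fun y => liveProd n (fun i => c (y i)))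
      ((measurable_liveProd_comp hc).comp measurable_prodMk_left)
    rw [Real.norm_of_nonneg this.1]
    exact this.2

theorem integral_veto (hc : Measurable c) :
    ∫ q, (veto q.1 (fun i => c (q.2 i)) : ℝ)
      ∂(d.prod (Measure.infinitePi fun _ : ℕ => ρ)) = 1 - genFun d (∫ a, (c a : ℝ) ∂ρ) := by
  simp only [coe_veto]
  rw [integral_sub (integrable_const _) (integrable_coe (measurable_liveProd_comp hc)),
    integral_liveProd ρ d hc]
  simp

/-- Expand `(1 - B) * (1 - C)`: both products run over the same family, so `B * C` is the product of
the `b * c`. The general space `A` serves both laws on `[0,1]` and functions on the tree. -/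
theorem integral_veto_mul_veto {b : A → I} (hb : Measurable b) (hc : Measurable c) :
    ∫ q, (veto q.1 (fun i => b (q.2 i)) : ℝ) * veto q.1 (fun i => c (q.2 i))
      ∂(d.prod (Measure.infinitePi fun _ : ℕ => ρ)) =
      1 - genFun d (∫ a, (b a : ℝ) ∂ρ) - genFun d (∫ a, (c a : ℝ) ∂ρ) +
        genFun d (∫ a, (b a : ℝ) * c a ∂ρ) := by
  have hbc : Measurable fun a => b a * c a := hb.mul hc
  have h (q : ℕ∞ × (ℕ → A)) :
      (veto q.1 (fun i => b (q.2 i)) : ℝ) * veto q.1 (fun i => c (q.2 i)) =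
      1 - (liveProd q.1 (fun i => b (q.2 i)) : ℝ) - (liveProd q.1 (fun i => c (q.2 i)) : ℝ) +
        (liveProd q.1 (fun i => b (q.2 i) * c (q.2 i)) : ℝ) := by
    rw [liveProd_mul, coe_veto, coe_veto]; push_cast; ring
  have ib := integrable_coe (P := d.prod (Measure.infinitePi fun _ : ℕ => ρ))
    (measurable_liveProd_comp hb)
  have ic := integrable_coe (P := d.prod (Measure.infinitePi fun _ : ℕ => ρ))
    (measurable_liveProd_comp hc)
  have ibc := integrable_coe (P := d.prod (Measure.infinitePi fun _ : ℕ => ρ))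
    (measurable_liveProd_comp hbc)
  simp only [h]
  rw [integral_add (by fun_prop) ibc, integral_sub (by fun_prop) ic, integral_sub (by fun_prop) ib,
    integral_liveProd ρ d hb, integral_liveProd ρ d hc, integral_liveProd ρ d hbc]
  simp

end LiveProd

/-! ### The basin of attraction and uniqueness of the invariant law. -/

section LawMap

variable (d : Measure ℕ∞) [IsProbabilityMeasure d]

/-- The second moment of a probability measure on `[0,1]`. -/
noncomputable def secondMoment (ν : ProbabilityMeasure I) : ℝ :=
  ∫ x : I, (x : ℝ) * x ∂(ν : Measure I)

theorem mean_mem (ν : ProbabilityMeasure I) : mean ν ∈ Icc (0 : ℝ) 1 :=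
  integral_coe_mem (c := id) measurable_id

theorem integrable_coe_mul_self (ν : ProbabilityMeasure I) :
    Integrable (fun x : I => (x : ℝ) * x) ν :=
  integrable_coe (c := fun x : I => x * x) (by fun_prop)

theorem secondMoment_le_mean (ν : ProbabilityMeasure I) : secondMoment ν ≤ mean ν :=
  integral_mono (integrable_coe_mul_self ν) (integrable_coe (c := id) measurable_id)
    fun x => mul_le_of_le_one_left x.2.1 x.2.2

theorem toMeasure_lawMap (ν : ProbabilityMeasure I) : (lawMap d ν : Measure I) =
    (d.prod (Measure.infinitePi fun _ : ℕ => (ν : Measure I))).map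
      fun q : ℕ∞ × (ℕ → I) => veto q.1 q.2 := rfl

theorem mean_lawMap (ν : ProbabilityMeasure I) : mean (lawMap d ν) = 1 - genFun d (mean ν) := by
  rw [mean, toMeasure_lawMap,
    integral_map measurable_veto.aemeasurable (Measurable.aestronglyMeasurable (by fun_prop))]
  exact integral_veto (ν : Measure I) d (c := id) measurable_id

theorem secondMoment_lawMap (ν : ProbabilityMeasure I) :
    secondMoment (lawMap d ν) = 1 - 2 * genFun d (mean ν) + genFun d (secondMoment ν) := by
  rw [secondMoment, toMeasure_lawMap,
    integral_map measurable_veto.aemeasurable (Measurable.aestronglyMeasurable (by fun_prop))]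
  have := integral_veto_mul_veto (ν : Measure I) d (b := id) (c := id) measurable_id measurable_id
  simp only [id] at this
  rw [this, mean, secondMoment]
  ring

theorem mean_iterate_lawMap (ν : ProbabilityMeasure I) (n : ℕ) :
    mean ((lawMap d)^[n] ν) = (fun t : ℝ => 1 - genFun d t)^[n] (mean ν) := by
  induction n with
  | zero => rfl
  | succ n ih => rw [Function.iterate_succ_apply', Function.iterate_succ_apply', mean_lawMap, ih]

theorem continuous_mean : Continuous mean := by
  refine continuous_iff_continuousAt.2 fun ν => ?_
  exact ProbabilityMeasure.tendsto_iff_forall_integral_tendsto.1 tendsto_id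
    (BoundedContinuousFunction.mkOfCompact ⟨fun x : I => (x : ℝ), continuous_subtype_val⟩)

/-- A continuous function on `[0,1]` that vanishes at both ends is dominated, up to `ε`, by a
multiple of `x (1 - x)`. -/
theorem exists_abs_le_add_mul {h : I → ℝ} (hh : Continuous h) (h0 : h 0 = 0) (h1 : h 1 = 0)
    {ε : ℝ} (hε : 0 < ε) : ∃ C : ℝ, ∀ x : I, |h x| ≤ ε + C * ((x : ℝ) - x * x) := by
  have hpos (x : I) : 0 ≤ (x : ℝ) - x * x := by nlinarith [x.2.1, x.2.2]
  have hK : IsCompact {x : I | ε ≤ |h x|} := (isClosed_le continuous_const hh.abs).isCompact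
  obtain ⟨M, hM⟩ := isCompact_univ.exists_bound_of_continuousOn (f := h) hh.continuousOn
  have hM0 : 0 ≤ M := (norm_nonneg _).trans (hM 0 (mem_univ _))
  rcases {x : I | ε ≤ |h x|}.eq_empty_or_nonempty with he | hne
  · refine ⟨0, fun x => ?_⟩
    have : x ∉ {x : I | ε ≤ |h x|} := by simp [he]
    simp only [mem_ofPred_eq, not_le] at this
    linarith
  · obtain ⟨x₀, hx₀, hmin⟩ := hK.exists_isMinOn hne
      (f := fun x : I => (x : ℝ) - x * x) (by fun_prop)
    have hc : 0 < (x₀ : ℝ) - x₀ * x₀ := by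
      refine (hpos x₀).lt_of_ne' fun hz => ?_
      rw [mem_ofPred_eq] at hx₀
      have : (x₀ : ℝ) * (1 - x₀) = 0 := by linarith
      rcases mul_eq_zero.1 this with hz | hz
      · rw [show x₀ = 0 from Subtype.ext hz, h0, abs_zero] at hx₀; linarith
      · rw [show x₀ = 1 from Subtype.ext (by simpa using (sub_eq_zero.1 hz).symm), h1,
          abs_zero] at hx₀
        linarith
    refine ⟨M / ((x₀ : ℝ) - x₀ * x₀), fun x => ?_⟩
    by_cases hx : ε ≤ |h x|
    · have h2 : (x₀ : ℝ) - x₀ * x₀ ≤ (x : ℝ) - x * x := hmin hx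
      have h3 : M ≤ M / ((x₀ : ℝ) - x₀ * x₀) * ((x : ℝ) - x * x) := by
        rw [div_mul_eq_mul_div, le_div_iff₀ hc]
        exact mul_le_mul_of_nonneg_left h2 hM0
      have := hM x (mem_univ _)
      rw [Real.norm_eq_abs] at this
      linarith
    · have := mul_nonneg (div_nonneg hM0 hc.le) (hpos x)
      linarith

/-- Compare a test function `g` with its affine interpolation `l` at `0` and `1`. The integral of
`l` depends only on the mean, and `g - l` is controlled by `x - x²`, whose integral vanishes in the
limit. -/
theorem tendsto_of_tendsto_moments {δ : ProbabilityMeasure I} (hδ : (δ : Measure I) {0, 1}ᶜ = 0)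
    {ν : ℕ → ProbabilityMeasure I} (h1 : Tendsto (fun n => mean (ν n)) atTop (𝓝 (mean δ)))
    (h2 : Tendsto (fun n => secondMoment (ν n)) atTop (𝓝 (mean δ))) :
    Tendsto ν atTop (𝓝 δ) := by
  refine ProbabilityMeasure.tendsto_iff_forall_integral_tendsto.2 fun g => ?_
  set l : I → ℝ := fun x => g 0 + (g 1 - g 0) * (x : ℝ) with hl
  have hlc : Continuous l := by fun_prop
  have hcoe (κ : ProbabilityMeasure I) : Integrable (fun x : I => (x : ℝ)) κ :=
    integrable_coe (c := id) measurable_id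
  have hli (κ : ProbabilityMeasure I) : Integrable l κ :=
    (integrable_const _).add ((hcoe κ).const_mul _)
  have hlm (κ : ProbabilityMeasure I) : ∫ x, l x ∂(κ : Measure I) =
      g 0 + (g 1 - g 0) * mean κ := by
    rw [hl, integral_add (integrable_const _) ((hcoe κ).const_mul _), integral_const_mul]
    simp [mean]
  have hgi (κ : ProbabilityMeasure I) : Integrable g κ := g.integrable _
  have hgδ : ∫ x, g x ∂(δ : Measure I) = g 0 + (g 1 - g 0) * mean δ := by
    rw [← hlm]
    refine integral_congr_ae ?_
    filter_upwards [compl_mem_ae_iff.2 hδ] with x hx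
    rw [compl_compl] at hx
    rcases hx with rfl | rfl <;> simp [hl]
  rw [hgδ]
  have key : Tendsto (fun n => ∫ x, (g x - l x) ∂(ν n : Measure I)) atTop (𝓝 0) := by
    refine Metric.tendsto_nhds.2 fun ε hε => ?_
    obtain ⟨C, hC⟩ := exists_abs_le_add_mul (h := fun x => g x - l x) (by fun_prop)
      (by simp [hl]) (by simp [hl]) (half_pos hε)
    have h3 : Tendsto (fun n => ε / 2 + C * (mean (ν n) - secondMoment (ν n))) atTop
        (𝓝 (ε / 2)) := by
      simpa using ((h1.sub h2).const_mul C).const_add (ε / 2)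
    filter_upwards [h3.eventually (gt_mem_nhds (half_lt_self hε))] with n hn
    rw [dist_zero_right]
    refine lt_of_le_of_lt (norm_integral_le_integral_norm _) (lt_of_le_of_lt ?_ hn)
    have hsub : Integrable (fun x : I => (x : ℝ) - x * x) (ν n) :=
      (hcoe (ν n)).sub (integrable_coe_mul_self (ν n))
    calc ∫ x, ‖g x - l x‖ ∂(ν n : Measure I)
        ≤ ∫ x : I, (ε / 2 + C * ((x : ℝ) - x * x)) ∂(ν n : Measure I) :=
          integral_mono ((hgi _).sub (hli _)).norm ((integrable_const _).add (hsub.const_mul C)) hC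
      _ = ε / 2 + C * (mean (ν n) - secondMoment (ν n)) := by
          rw [integral_add (integrable_const _) (hsub.const_mul C), integral_const_mul,
            integral_sub (hcoe _) (integrable_coe_mul_self _)]
          simp [mean, secondMoment]
  have h4 : Tendsto (fun n => g 0 + (g 1 - g 0) * mean (ν n)) atTop
      (𝓝 (g 0 + (g 1 - g 0) * mean δ)) := (h1.const_mul _).const_add _
  have h5 := key.add h4
  rw [zero_add] at h5
  refine h5.congr fun n => ?_
  rw [integral_sub (hgi _) (hli _), hlm]
  ring

variable {d} {δ : ProbabilityMeasure I}

theorem IsDiscreteLaw.mean_eq (hδ : IsDiscreteLaw d δ) : mean δ = 1 - genFun d (mean δ) := by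
  conv_lhs => rw [← hδ.invariant, mean_lawMap]

theorem basin_lawMap (hzero : genFun d 0 = 0)
    (hconv : StrictConvexOn ℝ (Icc (0 : ℝ) 1) (genFun d)) (hδ : IsDiscreteLaw d δ)
    (hstable : deriv (genFun d) (mean δ) ≤ 1) :
    basin (lawMap d) δ = {ν | mean ν ∈ basin (fun t : ℝ => 1 - genFun d t) (mean δ)} := by
  ext ν
  simp only [basin, mem_ofPred_eq, ← mean_iterate_lawMap]
  refine ⟨fun h => (continuous_mean.tendsto δ).comp h, fun h => ?_⟩
  refine tendsto_of_tendsto_moments hδ.concentrated h ?_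
  refine tendsto_second_moment hconv (fixed_mem_Ioo hzero (mean_mem δ) hδ.mean_eq) hδ.mean_eq
    hstable h (fun n => (mean_mem _).2) (fun n => integral_nonneg fun x => mul_self_nonneg _)
    (fun n => secondMoment_le_mean _) fun n => ?_
  rw [Function.iterate_succ_apply', secondMoment_lawMap]

theorem eq_of_lawMap_eq (hzero : genFun d 0 = 0)
    (hconv : StrictConvexOn ℝ (Icc (0 : ℝ) 1) (genFun d)) (hδ : IsDiscreteLaw d δ)
    (hstable : deriv (genFun d) (mean δ) ≤ 1) {ς : ProbabilityMeasure I}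
    (hς : lawMap d ς = ς) : ς = δ := by
  have hmean : mean ς = mean δ := eq_of_fixed (mean_mem δ) hδ.mean_eq (mean_mem ς)
    (by conv_lhs => rw [← hς, mean_lawMap])
  have hmem : ς ∈ basin (lawMap d) δ := by
    rw [basin_lawMap hzero hconv hδ hstable, mem_ofPred_eq, hmean, basin, mem_ofPred_eq]
    refine tendsto_const_nhds.congr fun n => (Function.iterate_fixed ?_ n).symm
    exact hδ.mean_eq.symm
  refine tendsto_nhds_unique ?_ hmem
  simp only [Function.iterate_fixed hς]
  exact tendsto_const_nhds

end LawMap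

/-! ### Invariance of the root law. -/

section TreeSolution

variable {d : Measure ℕ∞} [IsProbabilityMeasure d] {Ω : Type*} [MeasurableSpace Ω]
  {P : Measure Ω} [IsProbabilityMeasure P] {N : List ℕ → Ω → ℕ∞} {X : List ℕ → Ω → I}

/-- The law at the root of a tree-indexed solution is invariant. -/
theorem IsTreeSolution.lawMap_eq (h : IsTreeSolution P d N X) {ς : ProbabilityMeasure I}
    (hς : (ς : Measure I) = P.map (X [])) : lawMap d ς = ς := by
  let e : ℕ → {u : List ℕ // u.length = 1} := fun i => ⟨[i], rfl⟩
  have he : Function.Injective e := fun i j hij => by simpa [e] using hij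
  have hX : Measurable fun ω (i : ℕ) => X [i] ω :=
    measurable_pi_lambda _ fun i => h.measurable_sol _
  have h1 : P.map (fun ω (i : ℕ) => X [i] ω) = Measure.infinitePi fun _ : ℕ => (ς : Measure I) := by
    have := ((h.indep_level 1).precomp he).map_fun_eq_infinitePi_map
      (fun i => h.measurable_sol _)
    rw [show (fun ω (i : ℕ) => X [i] ω) = fun ω i => X (e i : List ℕ) ω from rfl, this]
    congr 1
    ext1 i
    rw [hς]
    exact h.stationary _
  have h2 : IndepFun (N []) (fun ω (i : ℕ) => X [i] ω) P := by
    have hφ : Measurable fun n : {v : List ℕ // v.length < 1} → ℕ∞ => n ⟨[], Nat.zero_lt_one⟩ :=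
      measurable_pi_apply _
    have hψ : Measurable fun (x : {u : List ℕ // u.length = 1} → I) i => x (e i) := by fun_prop
    exact (h.indep_past 1).symm.comp hφ hψ
  have h3 := (indepFun_iff_map_prod_eq_prod_map_map (h.measurable_size []).aemeasurable
    hX.aemeasurable).1 h2
  rw [h.law_size, h1] at h3
  refine Subtype.ext ?_
  change (lawMap d ς : Measure I) = (ς : Measure I)
  rw [toMeasure_lawMap, ← h3, Measure.map_map measurable_veto ((h.measurable_size []).prodMk hX), hς]
  refine Measure.map_congr ?_
  filter_upwards [h.recursion []] with ω hω
  simp [hω]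

end TreeSolution

/-! ### The branching property of the i.i.d. tree. -/

section Subtree

variable (d : Measure ℕ∞) [IsProbabilityMeasure d]

/-- The law of an i.i.d. family of family sizes, indexed by the nodes of the tree. -/
noncomputable abbrev treeMeasure : Measure (List ℕ → ℕ∞) := Measure.infinitePi fun _ => d

/-- The family sizes in the subtree rooted at `u`. -/
def subtree (u : List ℕ) (ω : List ℕ → ℕ∞) : List ℕ → ℕ∞ := fun v => ω (u ++ v)

theorem subtree_subtree (u v : List ℕ) (ω : List ℕ → ℕ∞) :
    subtree v (subtree u ω) = subtree (u ++ v) ω := by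
  ext w; simp [subtree]

theorem measurable_subtree (u : List ℕ) : Measurable (subtree u) :=
  measurable_pi_lambda _ fun _ => measurable_pi_apply _

theorem measurePreserving_subtree (u : List ℕ) :
    MeasurePreserving (subtree u) (treeMeasure d) (treeMeasure d) :=
  ⟨measurable_subtree u,
    Measure.map_infinitePi_infinitePi_of_inj (P := fun _ : List ℕ => d) (f := fun v => u ++ v)
      fun _ _ h => List.append_cancel_left h⟩

theorem map_subtree_level (n : ℕ) :
    (treeMeasure d).map (fun ω (u : {u : List ℕ // u.length = n}) => subtree u ω) =
      Measure.infinitePi fun _ => treeMeasure d := by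
  -- Prefixes of one common length make concatenation injective, so the subtrees use disjoint
  -- coordinates.
  have hinj : Function.Injective
      fun p : {u : List ℕ // u.length = n} × List ℕ => (p.1 : List ℕ) ++ p.2 := by
    rintro ⟨⟨u, hu⟩, v⟩ ⟨⟨u', hu'⟩, v'⟩ h
    obtain ⟨rfl, rfl⟩ := List.append_inj h (hu.trans hu'.symm)
    rfl
  have h := Measure.map_infinitePi_infinitePi_of_inj (P := fun _ : List ℕ => d) hinj
  rw [← Measure.infinitePi_map_curry (ι := {u : List ℕ // u.length = n}) (κ := List ℕ)
    (μ := fun _ _ => d), ← h, Measure.map_map (by fun_prop) (by fun_prop)]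
  rfl

theorem iIndepFun_subtree_level (n : ℕ) :
    iIndepFun (fun (u : {u : List ℕ // u.length = n}) ω => subtree u ω) (treeMeasure d) := by
  rw [iIndepFun_iff_map_fun_eq_infinitePi_map
    (X := fun (u : {u : List ℕ // u.length = n}) ω => subtree u ω) fun u => measurable_subtree u,
    map_subtree_level]
  congr 1
  ext1 u
  exact (measurePreserving_subtree d u).map_eq.symm

theorem indepFun_subtree_past (n : ℕ) :
    IndepFun (fun ω (u : {u : List ℕ // u.length = n}) => subtree u ω)
      (fun ω (v : {v : List ℕ // v.length < n}) => ω v) (treeMeasure d) := by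
  have h : iIndepFun (fun (u : List ℕ) (ω : List ℕ → ℕ∞) => ω u) (treeMeasure d) :=
    iIndepFun_infinitePi (X := fun _ x => x) fun _ => measurable_id
  have hST : Disjoint {u : List ℕ | n ≤ u.length} {u : List ℕ | u.length < n} :=
    Set.disjoint_left.2 fun u hu hu' => (mem_ofPred_eq ▸ hu).not_gt hu'
  have hind := indep_iSup_of_disjoint (fun u => (measurable_pi_apply u).comap_le) h hST
  refine indep_of_indep_of_le_left (indep_of_indep_of_le_right hind ?_) ?_
  · simp only [MeasurableSpace.pi, MeasurableSpace.comap_iSup, MeasurableSpace.comap_comp]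
    exact iSup_le fun v => le_iSup₂_of_le (v : List ℕ) v.2 le_rfl
  · simp only [MeasurableSpace.pi, MeasurableSpace.comap_iSup, MeasurableSpace.comap_comp]
    exact iSup_le fun u => iSup_le fun v =>
      le_iSup₂_of_le ((u : List ℕ) ++ v) (by simp [u.2]) le_rfl

/-- The root size and the daughter subtrees are independent, which moves the moment formulas from
the product space to the tree. -/
theorem measurePreserving_branch :
    MeasurePreserving (fun ω : List ℕ → ℕ∞ => (ω [], fun i : ℕ => subtree [i] ω))
      (treeMeasure d) (d.prod (Measure.infinitePi fun _ : ℕ => treeMeasure d)) := by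
  let e : ℕ → {u : List ℕ // u.length = 1} := fun i => ⟨[i], rfl⟩
  have he : Function.Injective e := fun i j hij => by simpa [e] using hij
  have hs : Measurable fun (ω : List ℕ → ℕ∞) (i : ℕ) => subtree [i] ω :=
    measurable_pi_lambda _ fun i => measurable_subtree _
  have h1 : (treeMeasure d).map (fun ω (i : ℕ) => subtree [i] ω) =
      Measure.infinitePi fun _ : ℕ => treeMeasure d := by
    have := ((iIndepFun_subtree_level d 1).precomp he).map_fun_eq_infinitePi_map
      (fun i => measurable_subtree _)
    rw [show (fun ω (i : ℕ) => subtree [i] ω) = fun ω i => subtree (e i) ω from rfl, this]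
    congr 1
    ext1 i
    exact (measurePreserving_subtree d _).map_eq
  have h2 : IndepFun (fun ω : List ℕ → ℕ∞ => ω []) (fun ω (i : ℕ) => subtree [i] ω)
      (treeMeasure d) := by
    have hφ : Measurable fun n : {v : List ℕ // v.length < 1} → ℕ∞ => n ⟨[], Nat.zero_lt_one⟩ :=
      measurable_pi_apply _
    have hψ : Measurable
        fun (x : {u : List ℕ // u.length = 1} → List ℕ → ℕ∞) i => x (e i) := by fun_prop
    exact (indepFun_subtree_past d 1).symm.comp hφ hψ
  refine ⟨(measurable_pi_apply _).prodMk hs, ?_⟩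
  rw [(indepFun_iff_map_prod_eq_prod_map_map (measurable_pi_apply _).aemeasurable
    hs.aemeasurable).1 h2, h1, Measure.infinitePi_map_eval]

/-- One step of the recursion: the value at the root, if the daughters carry the values `a` of
their subtrees. -/
noncomputable def step (a : (List ℕ → ℕ∞) → I) (ω : List ℕ → ℕ∞) : I :=
  veto (ω []) fun i => a (subtree [i] ω)

variable {a b : (List ℕ → ℕ∞) → I}

theorem measurable_veto_comp {A : Type*} [MeasurableSpace A] {c : A → I} (hc : Measurable c) :
    Measurable fun q : ℕ∞ × (ℕ → A) => veto q.1 fun i => c (q.2 i) :=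
  measurable_veto.comp (f := fun q : ℕ∞ × (ℕ → A) => (q.1, fun i => c (q.2 i))) (by fun_prop)

theorem measurable_step (ha : Measurable a) : Measurable (step a) :=
  (measurable_veto_comp ha).comp
    ((measurable_pi_apply _).prodMk (measurable_pi_lambda _ fun i => measurable_subtree [i]))

theorem integral_step (ha : Measurable a) :
    ∫ ω, (step a ω : ℝ) ∂treeMeasure d = 1 - genFun d (∫ ω, (a ω : ℝ) ∂treeMeasure d) := by
  have hm := measurable_veto_comp ha
  rw [← integral_veto _ d ha, ← (measurePreserving_branch d).map_eq,
    integral_map (measurePreserving_branch d).aemeasurable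
      hm.subtype_val.aestronglyMeasurable]
  rfl

theorem integral_step_mul_step (ha : Measurable a) (hb : Measurable b) :
    ∫ ω, (step a ω : ℝ) * step b ω ∂treeMeasure d =
      1 - genFun d (∫ ω, (a ω : ℝ) ∂treeMeasure d) - genFun d (∫ ω, (b ω : ℝ) ∂treeMeasure d) +
        genFun d (∫ ω, (a ω : ℝ) * b ω ∂treeMeasure d) := by
  have hm := measurable_veto_comp ha
  have hm' := measurable_veto_comp hb
  rw [← integral_veto_mul_veto _ d ha hb, ← (measurePreserving_branch d).map_eq,
    integral_map (measurePreserving_branch d).aemeasurable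
      (by exact (hm.subtype_val.mul hm'.subtype_val).aestronglyMeasurable)]
  rfl

/-- A fixed point of one step of the recursion gives an endogenous tree-indexed solution. -/
theorem isEndogenousLaw_of_step_eq (ha : Measurable a)
    (hfix : ∀ᵐ ω ∂treeMeasure d, step a ω = a ω) :
    IsEndogenousLaw d ⟨(treeMeasure d).map a, Measure.isProbabilityMeasure_map ha.aemeasurable⟩ := by
  have hmap (u : List ℕ) :
      (treeMeasure d).map (fun ω => a (subtree u ω)) = (treeMeasure d).map a := by
    rw [← (measurePreserving_subtree d u).map_eq, Measure.map_map ha (measurable_subtree u),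
      (measurePreserving_subtree d u).map_eq]
    rfl
  refine ⟨List ℕ → ℕ∞, inferInstance, treeMeasure d, fun u ω => ω u, fun u ω => a (subtree u ω),
    inferInstance, ?_, fun u => ⟨fun ω => a (subtree u ω), ha.comp (measurable_subtree u),
      ae_of_all _ fun _ => rfl⟩, (hmap []).symm⟩
  refine
    { measurable_size := fun u => measurable_pi_apply u
      law_size := fun u => Measure.infinitePi_map_eval _ u
      indep_size := iIndepFun_infinitePi (X := fun _ x => x) fun _ => measurable_id
      measurable_sol := fun u => ha.comp (measurable_subtree u)
      indep_level := fun n => (iIndepFun_subtree_level d n).comp (fun _ => a) fun _ => ha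
      indep_past := fun n => ?_
      recursion := fun u => ?_
      stationary := fun u => (hmap u).trans (hmap []).symm }
  · have hφ : Measurable
        fun (x : {u : List ℕ // u.length = n} → List ℕ → ℕ∞) u => a (x u) := by fun_prop
    exact (indepFun_subtree_past d n).comp hφ measurable_id
  · filter_upwards [(measurePreserving_subtree d u).quasiMeasurePreserving.ae hfix] with ω hω
    rw [← hω, step]
    simp [subtree_subtree, subtree]

end Subtree

/-! ### Mean-square Cauchy sequences and their limits. -/

section Limit

variable {Ω : Type*} [MeasurableSpace Ω] {P : Measure Ω} [IsProbabilityMeasure P]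

theorem integrable_coe_mul {a b : Ω → I} (ha : Measurable a) (hb : Measurable b) :
    Integrable (fun ω => (a ω : ℝ) * b ω) P :=
  integrable_coe (c := fun ω => a ω * b ω) (ha.mul hb)

theorem integrable_sub_mul_self {a b : Ω → I} (ha : Measurable a) (hb : Measurable b) :
    Integrable (fun ω => ((a ω : ℝ) - b ω) * ((a ω : ℝ) - b ω)) P := by
  refine .of_bound (Measurable.aestronglyMeasurable (by fun_prop)) 1 (ae_of_all _ fun ω => ?_)
  rw [Real.norm_of_nonneg (mul_self_nonneg _)]
  nlinarith [(a ω).2.1, (a ω).2.2, (b ω).2.1, (b ω).2.2]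

theorem integral_sub_mul_self {a b : Ω → I} (ha : Measurable a) (hb : Measurable b) :
    ∫ ω, ((a ω : ℝ) - b ω) * ((a ω : ℝ) - b ω) ∂P =
      ∫ ω, (a ω : ℝ) * a ω ∂P - 2 * ∫ ω, (a ω : ℝ) * b ω ∂P + ∫ ω, (b ω : ℝ) * b ω ∂P := by
  have h (ω : Ω) : ((a ω : ℝ) - b ω) * ((a ω : ℝ) - b ω) =
      (a ω : ℝ) * a ω - 2 * ((a ω : ℝ) * b ω) + (b ω : ℝ) * b ω := by ring
  have haa := integrable_coe_mul (P := P) ha ha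
  have hab := integrable_coe_mul (P := P) ha hb
  have hbb := integrable_coe_mul (P := P) hb hb
  simp only [h]
  rw [integral_add (by fun_prop) hbb, integral_sub haa (by fun_prop), integral_const_mul]

theorem eLpNorm_one_coe_sub_lt {a b : Ω → I} (ha : Measurable a) (hb : Measurable b) {ε : ℝ}
    (hε : 0 < ε) (h : ∫ ω, ((a ω : ℝ) - b ω) * ((a ω : ℝ) - b ω) ∂P < ε * ε) :
    eLpNorm ((fun ω => (a ω : ℝ)) - fun ω => (b ω : ℝ)) 1 P < ENNReal.ofReal ε := by
  have hint : Integrable (fun ω => (a ω : ℝ) - b ω) P := (integrable_coe ha).sub (integrable_coe hb)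
  have hsq := integrable_sub_mul_self (P := P) ha hb
  rw [eLpNorm_one_eq_lintegral_enorm]
  change ∫⁻ ω, ‖(a ω : ℝ) - b ω‖ₑ ∂P < _
  rw [← ofReal_integral_norm_eq_lintegral_enorm hint]
  refine (ENNReal.ofReal_lt_ofReal_iff hε).2 ?_
  -- Young's inequality, weighted so that each term contributes `ε / 2`.
  have hle (ω : Ω) : ‖(a ω : ℝ) - b ω‖ ≤
      ε / 2 + (2 * ε)⁻¹ * (((a ω : ℝ) - b ω) * ((a ω : ℝ) - b ω)) := by
    rw [← abs_mul_abs_self, ← Real.norm_eq_abs]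
    have := sq_nonneg (‖(a ω : ℝ) - b ω‖ - ε)
    field_simp
    nlinarith
  have h2 := integral_mono hint.norm ((integrable_const _).add (hsq.const_mul _)) hle (μ := P)
  rw [Pi.add_def, integral_add (integrable_const _) (hsq.const_mul _), integral_const_mul] at h2
  have h3 := mul_lt_mul_of_pos_left h (show 0 < (2 * ε)⁻¹ by positivity)
  have h4 : (2 * ε)⁻¹ * (ε * ε) = ε / 2 := by field_simp
  simp only [integral_const, probReal_univ, one_smul] at h2
  linarith

/-- A sequence of `[0,1]`-valued variables whose increments are orthogonal to the past has an
almost sure limit along a subsequence, which determines the limits of the mixed moments. -/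
theorem exists_limit_of_orthogonal_increments {D : ℕ → Ω → I} (hD : ∀ n, Measurable (D n))
    {q : ℕ → ℝ} {m : ℝ} (hq : ∀ n k, ∫ ω, (D n ω : ℝ) * D (n + k) ω ∂P = q n)
    (hqm : Tendsto q atTop (𝓝 m)) (hmean : ∀ n, ∫ ω, (D n ω : ℝ) ∂P = m) :
    ∃ G : Ω → I, Measurable G ∧ ∫ ω, (G ω : ℝ) ∂P = m ∧ ∫ ω, (G ω : ℝ) * G ω ∂P = m ∧
      ∀ n, ∫ ω, (G ω : ℝ) * D n ω ∂P = q n := by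
  have hself n : ∫ ω, (D n ω : ℝ) * D n ω ∂P = q n := hq n 0
  have hdist (i j : ℕ) (hij : i ≤ j) :
      ∫ ω, ((D i ω : ℝ) - D j ω) * ((D i ω : ℝ) - D j ω) ∂P = q j - q i := by
    obtain ⟨k, rfl⟩ := Nat.exists_eq_add_of_le hij
    rw [integral_sub_mul_self (hD _) (hD _), hself, hself, hq]
    ring
  -- Squared distances are differences of `q`. These tolerances bound them by `(1 / 2) ^ M` squared,
  -- so the `L¹` distances are summable.
  obtain ⟨φ, hφ, hφq⟩ := extraction_forall_of_eventually'
    (P := fun j k => ∀ l ≥ k, |q l - m| < (1 / 2) ^ j * (1 / 2) ^ j / 2) fun j => by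
      obtain ⟨K, hK⟩ := Metric.tendsto_atTop.1 hqm ((1 / 2) ^ j * (1 / 2) ^ j / 2) (by positivity)
      exact ⟨K, fun k hk l hl => hK l (hk.trans hl)⟩
  have hcau (M i j : ℕ) (hi : M ≤ i) (hj : M ≤ j) :
      eLpNorm ((fun ω => (D (φ i) ω : ℝ)) - fun ω => (D (φ j) ω : ℝ)) 1 P <
        ENNReal.ofReal ((1 / 2) ^ M) := by
    wlog hij : i ≤ j generalizing i j
    · rw [eLpNorm_sub_comm]
      exact this j i hj hi (le_of_not_ge hij)
    refine eLpNorm_one_coe_sub_lt (hD _) (hD _) (by positivity) ?_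
    rw [hdist _ _ (hφ.monotone hij)]
    have h1 := abs_lt.1 (hφq M _ (hφ.monotone hi))
    have h2 := abs_lt.1 (hφq M _ (hφ.monotone hj))
    linarith
  have hconv : ∀ᵐ ω ∂P, Tendsto (fun j => D (φ j) ω) atTop
      (𝓝 (limsup (fun j => D (φ j) ω) atTop)) := by
    have := Lp.ae_tendsto_of_cauchy_eLpNorm (f := fun j ω => (D (φ j) ω : ℝ)) (μ := P) (p := 1)
      (fun j => ((hD _).subtype_val).aestronglyMeasurable) le_rfl
      (B := fun M => ENNReal.ofReal ((1 / 2) ^ M))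
      (Summable.tsum_ofReal_ne_top summable_geometric_two) hcau
    filter_upwards [this] with ω ⟨l, hl⟩
    have hlI : l ∈ Icc (0 : ℝ) 1 :=
      isClosed_Icc.mem_of_tendsto hl (Eventually.of_forall fun j => (D (φ j) ω).2)
    have hl' : Tendsto (fun j => D (φ j) ω) atTop (𝓝 (⟨l, hlI⟩ : I)) :=
      tendsto_subtype_rng.2 hl
    rwa [hl'.limsup_eq]
  -- The limsup is measurable everywhere and agrees with the limit almost surely.
  set G : Ω → I := fun ω => limsup (fun j => D (φ j) ω) atTop with hGdef
  have hG : Measurable G := Measurable.limsup fun j => hD _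
  have hdom {F : ℕ → Ω → I} {f : Ω → I} (hF : ∀ j, Measurable (F j))
      (h : ∀ᵐ ω ∂P, Tendsto (fun j => F j ω) atTop (𝓝 (f ω))) :
      Tendsto (fun j => ∫ ω, (F j ω : ℝ) ∂P) atTop (𝓝 (∫ ω, (f ω : ℝ) ∂P)) := by
    refine tendsto_integral_of_dominated_convergence (fun _ => 1)
      (fun j => (hF j).subtype_val.aestronglyMeasurable) (integrable_const _)
      (fun j => ae_of_all _ fun ω => ?_) ?_
    · rw [Real.norm_of_nonneg (F j ω).2.1]; exact (F j ω).2.2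
    · filter_upwards [h] with ω hω using (continuous_subtype_val.tendsto _).comp hω
  refine ⟨G, hG, ?_, ?_, fun n => ?_⟩
  · refine tendsto_nhds_unique (hdom (fun j => hD (φ j)) hconv) ?_
    simp [hmean]
  · have := hdom (F := fun j ω => D (φ j) ω * D (φ j) ω) (f := fun ω => G ω * G ω)
      (fun j => (hD _).mul (hD _)) (by filter_upwards [hconv] with ω hω using hω.mul hω)
    refine tendsto_nhds_unique this ?_
    simpa [hself, Function.comp_def] using hqm.comp hφ.tendsto_atTop
  · have := hdom (F := fun j ω => D (φ j) ω * D n ω) (f := fun ω => G ω * D n ω)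
      (fun j => (hD _).mul (hD _))
      (by filter_upwards [hconv] with ω hω using hω.mul tendsto_const_nhds)
    refine tendsto_nhds_unique this (tendsto_const_nhds.congr' ?_)
    filter_upwards [eventually_ge_atTop n] with j hj
    obtain ⟨k, hk⟩ := Nat.exists_eq_add_of_le (hj.trans (hφ.id_le j))
    rw [← hq n k, ← hk]
    exact integral_congr_ae (ae_of_all _ fun ω => by simp [mul_comm])

end Limit

/-! ### Construction of an endogenous solution. -/

section Existence

variable {d : Measure ℕ∞} [IsProbabilityMeasure d]

theorem exists_step_eq (hconv : StrictConvexOn ℝ (Icc (0 : ℝ) 1) (genFun d)) {m : ℝ}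
    (hm : m ∈ Ioo (0 : ℝ) 1) (hfix : m = 1 - genFun d m) (hstable : deriv (genFun d) m ≤ 1) :
    ∃ G : (List ℕ → ℕ∞) → I, Measurable G ∧ ∀ᵐ ω ∂treeMeasure d, step G ω = G ω := by
  -- Starting at the fixed point keeps all means equal to `m`. The constant start also makes the
  -- mixed moments independent of `k`: at `n = 0` each is `m * m`, and `step` preserves this.
  let D : ℕ → (List ℕ → ℕ∞) → I := fun n => step^[n] fun _ => ⟨m, hm.1.le, hm.2.le⟩
  have hDs n : D (n + 1) = step (D n) := Function.iterate_succ_apply' _ _ _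
  have hD n : Measurable (D n) := by
    induction n with
    | zero => exact measurable_const
    | succ n ih => rw [hDs]; exact measurable_step ih
  have hmean n : ∫ ω, (D n ω : ℝ) ∂treeMeasure d = m := by
    induction n with
    | zero => simp [D]
    | succ n ih => rw [hDs, integral_step d (hD n), ih, ← hfix]
  let q : ℕ → ℝ := fun n => ∫ ω, (D n ω : ℝ) * D n ω ∂treeMeasure d
  have hq n k : ∫ ω, (D n ω : ℝ) * D (n + k) ω ∂treeMeasure d = q n := by
    induction n generalizing k with
    | zero =>
      change ∫ ω, m * (D (0 + k) ω : ℝ) ∂treeMeasure d = ∫ ω, m * m ∂treeMeasure d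
      rw [integral_const_mul, hmean]
      simp
    | succ n ih =>
      have h0 : q (n + 1) = ∫ ω, (step (D n) ω : ℝ) * step (D n) ω ∂treeMeasure d := by
        simp only [q, hDs]
      rw [h0, Nat.add_right_comm, hDs, hDs, integral_step_mul_step d (hD _) (hD _),
        integral_step_mul_step d (hD _) (hD _), ih, hmean, hmean]
  have hqs n : q (n + 1) = 1 - 2 * genFun d m + genFun d (q n) := by
    simp only [q, hDs]
    rw [integral_step_mul_step d (hD n) (hD n), hmean]
    ring
  have hqm : Tendsto q atTop (𝓝 m) := by
    refine tendsto_second_moment hconv hm hfix hstable (a := fun _ => m) tendsto_const_nhds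
      (fun _ => hm.2.le) (fun n => integral_nonneg fun ω => mul_self_nonneg _) (fun n => ?_) hqs
    rw [← hmean n]
    exact integral_mono (integrable_coe_mul (hD n) (hD n)) (integrable_coe (hD n))
      fun ω => mul_le_of_le_one_left (D n ω).2.1 (D n ω).2.2
  obtain ⟨G, hG, hG1, hG2, hGD⟩ := exists_limit_of_orthogonal_increments hD hq hqm hmean
  refine ⟨G, hG, ?_⟩
  have hS := measurable_step hG
  -- `step G` and `G` have the same moments against `D (n + 1)`, so both are at squared distance `m
  -- - q (n + 1)` from it; this tends to `0`.
  have hSD n : ∫ ω, ((step G ω : ℝ) - D (n + 1) ω) * ((step G ω : ℝ) - D (n + 1) ω)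
      ∂treeMeasure d = m - q (n + 1) := by
    have h1 : ∫ ω, (step G ω : ℝ) * D (n + 1) ω ∂treeMeasure d = q (n + 1) := by
      rw [hqs, hDs, integral_step_mul_step d hG (hD n), hG1, hmean, hGD]
      ring
    rw [integral_sub_mul_self hS (hD _), h1, integral_step_mul_step d hG hG, hG1, hG2]
    change _ - _ + q (n + 1) = _
    linarith
  have hGD' n : ∫ ω, ((G ω : ℝ) - D (n + 1) ω) * ((G ω : ℝ) - D (n + 1) ω)
      ∂treeMeasure d = m - q (n + 1) := by
    rw [integral_sub_mul_self hG (hD _), hGD, hG2]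
    change _ - _ + q (n + 1) = _
    ring
  have hle n : ∫ ω, ((step G ω : ℝ) - G ω) * ((step G ω : ℝ) - G ω) ∂treeMeasure d ≤
      4 * (m - q (n + 1)) := by
    have h1 := integrable_sub_mul_self (P := treeMeasure d) hS (hD (n + 1))
    have h2 := integrable_sub_mul_self (P := treeMeasure d) hG (hD (n + 1))
    calc _ ≤ ∫ ω, (2 * (((step G ω : ℝ) - D (n + 1) ω) * ((step G ω : ℝ) - D (n + 1) ω)) +
          2 * (((G ω : ℝ) - D (n + 1) ω) * ((G ω : ℝ) - D (n + 1) ω))) ∂treeMeasure d :=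
          integral_mono (integrable_sub_mul_self hS hG) (by fun_prop) fun ω => by
            nlinarith [sq_nonneg ((step G ω : ℝ) + G ω - 2 * D (n + 1) ω)]
      _ = 4 * (m - q (n + 1)) := by
          rw [integral_add (by fun_prop) (by fun_prop), integral_const_mul, integral_const_mul,
            hSD, hGD']
          ring
  have hlim : Tendsto (fun n => 4 * (m - q (n + 1))) atTop (𝓝 0) := by
    simpa using (((tendsto_add_atTop_iff_nat 1).2 hqm).const_sub m).const_mul 4
  have hzero := (ge_of_tendsto' hlim hle).antisymm (integral_nonneg fun ω => mul_self_nonneg _)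
  rw [integral_eq_zero_iff_of_nonneg (fun ω => mul_self_nonneg _) (integrable_sub_mul_self hS hG)] at hzero
  filter_upwards [hzero] with ω hω
  exact Subtype.ext (sub_eq_zero.1 (mul_self_eq_zero.1 hω))

end Existence

end NoisyVeto

theorem theorem5p4 (d : Measure ℕ∞) [IsProbabilityMeasure d]
    (hzero : NoisyVeto.genFun d 0 = 0)
    (hconv : StrictConvexOn ℝ (Set.Icc (0 : ℝ) 1) (NoisyVeto.genFun d))
    (δ : ProbabilityMeasure unitInterval) (hδ : NoisyVeto.IsDiscreteLaw d δ)
    (hstable : deriv (NoisyVeto.genFun d) (NoisyVeto.mean δ) ≤ 1) :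
    (∃ ς : ProbabilityMeasure unitInterval, NoisyVeto.IsEndogenousLaw d ς) ∧
    ∀ ς : ProbabilityMeasure unitInterval, NoisyVeto.IsEndogenousLaw d ς →
      ς = δ ∧
      NoisyVeto.basin (NoisyVeto.lawMap d) ς =
        {ν : ProbabilityMeasure unitInterval | NoisyVeto.mean ν ∈
          NoisyVeto.basin (fun t : ℝ => 1 - NoisyVeto.genFun d t) (NoisyVeto.mean δ)} := by
  refine ⟨?_, ?_⟩
  · obtain ⟨G, hG, hfix⟩ := NoisyVeto.exists_step_eq hconv
      (NoisyVeto.fixed_mem_Ioo hzero (NoisyVeto.mean_mem δ) hδ.mean_eq) hδ.mean_eq hstable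
    exact ⟨_, NoisyVeto.isEndogenousLaw_of_step_eq d hG hfix⟩
  · rintro ς ⟨Ω, _, P, N, X, _, hX, -, hς⟩
    obtain rfl := NoisyVeto.eq_of_lawMap_eq hzero hconv hδ hstable (hX.lawMap_eq hς)
    exact ⟨rfl, NoisyVeto.basin_lawMap hzero hconv hδ hstable⟩
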